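/- Let $F$ be the integral quaternary quadratic form $$F(x,y,z,u) = 4(2x^2+2y^2+2z^2-2xy-2xz+yz) + 2u(4u-x-y-z)$$ on $\mathbb{Z}^4$. Call $v=(x,y,z,u)\in\mathbb{Z}^4$ primitive if $\gcd(x,y,z,u)=1$, and let $\mathrm{PIm}(F)=\{F(v) : v\in\mathbb{Z}^4 \text{ primitive}\}$ be the primitive image of $F$. Then $F$ is positive definite, that is, $F(v)>0$ for every nonzero $v \in \mathbb{Z}^4$, and its primitive image is exactly the Hassett set: $$\mathrm{PIm}(F)=\mathcal{H}:=\{n\in\mathbb{Z} : n\ge 8,\ n\equiv 0 \text{ or } 2 \pmod 6\}.$$ -/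

import Mathlib

/-- An integer vector is primitive if the greatest common divisor of its coordinates is `1`. -/
def IsPrimitiveVector {n : ℕ} (v : Fin n → ℤ) : Prop :=
  Finset.univ.gcd v = 1

/-- The primitive image of an integral quadratic form: its values at primitive vectors. -/
def primitiveImage {n : ℕ} (Q : QuadraticForm ℤ (Fin n → ℤ)) : Set ℤ :=
  {m | ∃ v : Fin n → ℤ, IsPrimitiveVector v ∧ Q v = m}

/-- The Hassett subset `{n ≥ 8 : n ≡ 0, 2 mod 6}`. -/
def hassettSet : Set ℤ :=
  {n | 8 ≤ n ∧ (n ≡ 0 [ZMOD 6] ∨ n ≡ 2 [ZMOD 6])}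

/-- The polynomial `4(2x² + 2y² + 2z² - 2xy - 2xz + yz) + 2u(4u - x - y - z)`. -/
def formFPoly (x y z u : ℤ) : ℤ :=
  4 * (2 * x ^ 2 + 2 * y ^ 2 + 2 * z ^ 2 - 2 * x * y - 2 * x * z + y * z)
    + 2 * u * (4 * u - x - y - z)

/-- The bilinear form whose value on the diagonal is `2 F`, where `F` is `formF` below; it serves
only to show that the polynomial above defines a quadratic form. -/
def formFPolar : LinearMap.BilinForm ℤ (Fin 4 → ℤ) :=
  LinearMap.mk₂ ℤ
    (fun v w =>
      16 * (v 0 * w 0 + v 1 * w 1 + v 2 * w 2 + v 3 * w 3)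
        - 8 * (v 0 * w 1 + v 1 * w 0) - 8 * (v 0 * w 2 + v 2 * w 0)
        + 4 * (v 1 * w 2 + v 2 * w 1)
        - 2 * (v 3 * (w 0 + w 1 + w 2) + (v 0 + v 1 + v 2) * w 3))
    (fun v v' w => by simp only [Pi.add_apply]; ring)
    (fun c v w => by simp only [Pi.smul_apply, smul_eq_mul]; ring)
    (fun v w w' => by simp only [Pi.add_apply]; ring)
    (fun c v w => by simp only [Pi.smul_apply, smul_eq_mul]; ring)

/-- The integral quaternary quadratic form `F` on vectors `(x, y, z, u)`. -/
def formF : QuadraticForm ℤ (Fin 4 → ℤ) where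
  toFun v := formFPoly (v 0) (v 1) (v 2) (v 3)
  toFun_smul c v := by
    simp only [formFPoly, Pi.smul_apply, smul_eq_mul]; ring
  exists_companion' := ⟨formFPolar, fun v w => by
    simp only [formFPoly, formFPolar, LinearMap.mk₂_apply, Pi.add_apply]; ring⟩

theorem formF_apply (v : Fin 4 → ℤ) : formF v = formFPoly (v 0) (v 1) (v 2) (v 3) := rfl

/-! Write F = 2h. Completing squares turns 16h into A² + 3B² + 3C² + 57u², and h is a square modulo
3; this gives positivity, the congruence and the lower bound. Conversely, for odd u, h takes the
value m as soon as 16m - 57u² has the form X² + 3Y² + 3Z² (`exists_halfF_eq`). Fixing u = 1, or u =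
3 when u = 1 fails modulo 9, also controls primitivity. Multiplying or dividing by 3 reduces this
ternary problem to x² + y² + 3z² = M with M ≡ 5 (mod 8). As in Dirichlet's proof of the three-square
theorem, a prime in an arithmetic progression yields a form of determinant 3 with value M, reduction
leaves two candidate forms, and modulo 8 discards the wrong one (`represented_of_neg_isSquare`). -/

/-! ### Reduction of binary and ternary forms -/

/-- A positive definite binary form `p X² + 2 q X Y + r Y²` of determinant `D` takes at a vector that
is part of a basis a positive value `p'` with `3 p'² ≤ 4 D`. -/
theorem exists_binary_reduction (n : ℕ) : ∀ p q r D : ℤ, p.toNat = n → 0 < p → 0 < D →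
    p * r - q ^ 2 = D → ∃ α β γ δ : ℤ, α * δ - β * γ = 1 ∧
      0 < p * α ^ 2 + 2 * q * α * γ + r * γ ^ 2 ∧
      3 * (p * α ^ 2 + 2 * q * α * γ + r * γ ^ 2) ^ 2 ≤ 4 * D := by
  induction n using Nat.strong_induction_on with
  | _ n ih =>
  intro p q r D hn hp hD hdet
  by_cases hsmall : 3 * p ^ 2 ≤ 4 * D
  · exact ⟨1, 0, 0, 1, by norm_num, by simpa using hp, by simpa using hsmall⟩
  -- Round -q/p to a nearest integer t. Then p r' = D + q'² < p², so swapping the variables descends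
  -- from p to r'.
  obtain ⟨t, ht⟩ : ∃ t : ℤ, |2 * (q + t * p)| ≤ p := by
    refine ⟨-((2 * q + p) / (2 * p)), ?_⟩
    have h1 := Int.mul_ediv_add_emod (2 * q + p) (2 * p)
    have h2 := Int.emod_nonneg (2 * q + p) (by omega : 2 * p ≠ 0)
    have h3 := Int.emod_lt_of_pos (2 * q + p) (by omega : 0 < 2 * p)
    rw [abs_le]
    constructor <;> nlinarith
  set q' := q + t * p with hq'
  set r' := r + 2 * q * t + p * t ^ 2 with hr'
  have hdet' : p * r' - q' ^ 2 = D := by rw [← hdet, hq', hr']; ring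
  have hq2 : 4 * q' ^ 2 ≤ p ^ 2 := by
    have := sq_le_sq' (by linarith [abs_nonneg (2 * q'), neg_abs_le (2 * q')])
      ((le_abs_self _).trans ht)
    linarith
  have hr0 : 0 < r' := by
    by_contra h
    nlinarith [sq_nonneg q']
  have hrp : r' < p := by
    by_contra h
    nlinarith
  obtain ⟨α, β, γ, δ, h1, h2, h3⟩ := ih r'.toNat (by omega) r' (-q') p D rfl hr0 hD (by linarith)
  have key : p * (t * α - γ) ^ 2 + 2 * q * (t * α - γ) * α + r * α ^ 2
      = r' * α ^ 2 + 2 * (-q') * α * γ + p * γ ^ 2 := by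
    rw [hq', hr']; ring
  refine ⟨t * α - γ, t * β - δ, α, β, by linear_combination h1, ?_, ?_⟩
  · rw [key]; exact h2
  · rw [key]; exact h3

/-- The ternary quadratic form `a x² + b y² + c z² + 2 d y z + 2 e x z + 2 g x y`. -/
def ternaryForm (a b c d e g x y z : ℤ) : ℤ :=
  a * x ^ 2 + b * y ^ 2 + c * z ^ 2 + 2 * d * y * z + 2 * e * x * z + 2 * g * x * y

/-- The determinant of the symmetric matrix of `ternaryForm`. -/
def ternaryDet (a b c d e g : ℤ) : ℤ :=
  a * b * c + 2 * d * e * g - a * d ^ 2 - b * e ^ 2 - c * g ^ 2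

/-- Values of a ternary form of determinant `3` that splits off a unit vector. -/
theorem represented_of_unit_vector {b c d e g M : ℤ} (hD : 0 < b - g ^ 2)
    (hdet : ternaryDet 1 b c d e g = 3) (hM : ∃ x y z, ternaryForm 1 b c d e g x y z = M) :
    (∃ x y z : ℤ, x ^ 2 + y ^ 2 + 3 * z ^ 2 = M) ∨
      ∃ x y z : ℤ, x ^ 2 + 2 * (y ^ 2 + y * z + z ^ 2) = M := by
  obtain ⟨x, y, z, h⟩ := hM
  have hdet2 : (b - g ^ 2) * (c - e ^ 2) - (d - e * g) ^ 2 = 3 := by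
    rw [← hdet, ternaryDet]; ring
  obtain ⟨α, β, γ, δ, h1, h2, h3⟩ :=
    exists_binary_reduction _ (b - g ^ 2) (d - e * g) (c - e ^ 2) 3 rfl hD (by norm_num) hdet2
  set P := (b - g ^ 2) * α ^ 2 + 2 * (d - e * g) * α * γ + (c - e ^ 2) * γ ^ 2 with hP
  set Q := (b - g ^ 2) * α * β + (d - e * g) * (α * δ + β * γ) + (c - e ^ 2) * γ * δ with hQ
  set R := (b - g ^ 2) * β ^ 2 + 2 * (d - e * g) * β * δ + (c - e ^ 2) * δ ^ 2 with hR
  have hPQR : P * R - Q ^ 2 = 3 := by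
    have : P * R - Q ^ 2 = ((b - g ^ 2) * (c - e ^ 2) - (d - e * g) ^ 2) * (α * δ - β * γ) ^ 2 := by
      rw [hP, hQ, hR]; ring
    rw [this, hdet2, h1]; norm_num
  -- the coordinates of `(y, z)` in the reduced basis
  have hy : y = α * (δ * y - β * z) + β * (α * z - γ * y) := by linear_combination (-y) * h1
  have hz : z = γ * (δ * y - β * z) + δ * (α * z - γ * y) := by linear_combination (-z) * h1
  set Y := δ * y - β * z
  set Z := α * z - γ * y
  have hval : (x + g * y + e * z) ^ 2 + (P * Y ^ 2 + 2 * Q * Y * Z + R * Z ^ 2) = M := by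
    have : P * Y ^ 2 + 2 * Q * Y * Z + R * Z ^ 2 = (b - g ^ 2) * (α * Y + β * Z) ^ 2
        + 2 * (d - e * g) * (α * Y + β * Z) * (γ * Y + δ * Z)
        + (c - e ^ 2) * (γ * Y + δ * Z) ^ 2 := by
      rw [hP, hQ, hR]; ring
    rw [this, ← hy, ← hz, ← h, ternaryForm]; ring
  clear_value P Q R Y Z
  have hP2 : P ≤ 2 := by nlinarith
  obtain rfl | rfl : P = 1 ∨ P = 2 := by omega
  · left
    refine ⟨x + g * y + e * z, Y + Q * Z, Z, ?_⟩
    rw [← hval]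
    linear_combination (-Z ^ 2) * hPQR
  · right
    have hodd : Q % 2 = 1 := by
      rcases Int.emod_two_eq_zero_or_one Q with h0 | h0
      · obtain ⟨k, rfl⟩ := Int.dvd_of_emod_eq_zero h0
        exfalso
        have : 2 * (R - 2 * k ^ 2) = 3 := by linarith
        omega
      · exact h0
    obtain ⟨k, rfl⟩ : ∃ k, Q = 2 * k + 1 := ⟨Q / 2, by omega⟩
    refine ⟨x + g * y + e * z, Y + k * Z, Z, ?_⟩
    rw [← hval]
    have hR' : R = 2 * k ^ 2 + 2 * k + 2 := by linarith
    rw [hR']; ring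

/-- Every value of a positive definite classically integral ternary form of determinant `3` is a
value of one of the two reduced forms of that determinant. -/
theorem represented_of_ternaryDet_eq_three {M : ℤ} (n : ℕ) : ∀ a b c d e g : ℤ,
    (a + (a * b - g ^ 2)).toNat = n → 0 < a → 0 < a * b - g ^ 2 → ternaryDet a b c d e g = 3 →
    (∃ x y z, ternaryForm a b c d e g x y z = M) →
    (∃ x y z : ℤ, x ^ 2 + y ^ 2 + 3 * z ^ 2 = M) ∨
      ∃ x y z : ℤ, x ^ 2 + 2 * (y ^ 2 + y * z + z ^ 2) = M := by
  induction n using Nat.strong_induction_on with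
  | _ n ih =>
  intro a b c d e g hn ha hD hdet hM
  -- Reducing the form in x, y lowers `a` and keeps the minor.
  by_cases h1 : 3 * a ^ 2 ≤ 4 * (a * b - g ^ 2)
  swap
  · obtain ⟨α, β, γ, δ, hu, hpos, hle⟩ :=
      exists_binary_reduction _ a g b (a * b - g ^ 2) rfl ha hD rfl
    set a' := a * α ^ 2 + 2 * g * α * γ + b * γ ^ 2 with ha'
    have hDD : a' * (a * β ^ 2 + 2 * g * β * δ + b * δ ^ 2)
        - (a * α * β + g * (α * δ + β * γ) + b * γ * δ) ^ 2 = a * b - g ^ 2 := by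
      have : a' * (a * β ^ 2 + 2 * g * β * δ + b * δ ^ 2)
          - (a * α * β + g * (α * δ + β * γ) + b * γ * δ) ^ 2
          = (a * b - g ^ 2) * (α * δ - β * γ) ^ 2 := by rw [ha']; ring
      rw [this, hu]; ring
    have hlt : a' < a := by nlinarith
    obtain ⟨x, y, z, h⟩ := hM
    refine ih _ (by rw [hDD]; omega) a' (a * β ^ 2 + 2 * g * β * δ + b * δ ^ 2) c
      (d * δ + e * β) (e * α + d * γ) (a * α * β + g * (α * δ + β * γ) + b * γ * δ) rfl hpos
      (by rw [hDD]; exact hD) ?_ ⟨δ * x - β * y, α * y - γ * x, z, ?_⟩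
    · have : ternaryDet a' (a * β ^ 2 + 2 * g * β * δ + b * δ ^ 2) c
          (d * δ + e * β) (e * α + d * γ) (a * α * β + g * (α * δ + β * γ) + b * γ * δ)
          = ternaryDet a b c d e g * (α * δ - β * γ) ^ 2 := by
        rw [ha', ternaryDet, ternaryDet]; ring
      rw [this, hu, hdet]; norm_num
    · have hx : α * (δ * x - β * y) + β * (α * y - γ * x) = x := by linear_combination x * hu
      have hy : γ * (δ * x - β * y) + δ * (α * y - γ * x) = y := by linear_combination y * hu
      rw [← h]
      conv_rhs => rw [← hx, ← hy]
      rw [ha', ternaryForm, ternaryForm]; ring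
  -- Completing the square in x leaves a binary form of determinant 3a; reducing it lowers the minor
  -- and keeps `a`.
  by_cases h2 : (a * b - g ^ 2) ^ 2 ≤ 4 * a
  swap
  · have hdet2 : (a * b - g ^ 2) * (a * c - e ^ 2) - (a * d - e * g) ^ 2 = 3 * a := by
      rw [← hdet, ternaryDet]; ring
    obtain ⟨α, β, γ, δ, hu, hpos, hle⟩ := exists_binary_reduction _
      (a * b - g ^ 2) (a * d - e * g) (a * c - e ^ 2) (3 * a) rfl hD (by omega) hdet2
    have hDD : a * (b * α ^ 2 + 2 * d * α * γ + c * γ ^ 2) - (g * α + e * γ) ^ 2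
        = (a * b - g ^ 2) * α ^ 2 + 2 * (a * d - e * g) * α * γ + (a * c - e ^ 2) * γ ^ 2 := by
      ring
    rw [← hDD] at hpos hle
    have hlt : a * (b * α ^ 2 + 2 * d * α * γ + c * γ ^ 2) - (g * α + e * γ) ^ 2
        < a * b - g ^ 2 := by nlinarith
    obtain ⟨x, y, z, h⟩ := hM
    refine ih _ (by omega) a (b * α ^ 2 + 2 * d * α * γ + c * γ ^ 2)
      (b * β ^ 2 + 2 * d * β * δ + c * δ ^ 2) (b * α * β + d * (α * δ + β * γ) + c * γ * δ)
      (g * β + e * δ) (g * α + e * γ) rfl ha hpos ?_ ⟨x, δ * y - β * z, α * z - γ * y, ?_⟩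
    · have : ternaryDet a (b * α ^ 2 + 2 * d * α * γ + c * γ ^ 2)
          (b * β ^ 2 + 2 * d * β * δ + c * δ ^ 2) (b * α * β + d * (α * δ + β * γ) + c * γ * δ)
          (g * β + e * δ) (g * α + e * γ) = ternaryDet a b c d e g * (α * δ - β * γ) ^ 2 := by
        rw [ternaryDet, ternaryDet]; ring
      rw [this, hu, hdet]; norm_num
    · have hy : α * (δ * y - β * z) + β * (α * z - γ * y) = y := by linear_combination y * hu
      have hz : γ * (δ * y - β * z) + δ * (α * z - γ * y) = z := by linear_combination z * hu
      rw [← h]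
      conv_rhs => rw [← hy, ← hz]
      rw [ternaryForm, ternaryForm]; ring
  -- The two bounds combine to 9a⁴ ≤ 16D² ≤ 64a.
  have ha1 : a = 1 := by
    set D := a * b - g ^ 2
    clear_value D
    have : a < 2 := by
      by_contra h
      have h3 : a ^ 2 * (9 * a ^ 2) ≤ 16 * D ^ 2 := by nlinarith
      have h4 : a * (9 * a ^ 3) ≤ a * 64 := by nlinarith
      have h5 := le_of_mul_le_mul_left h4 ha
      nlinarith [mul_self_nonneg (a - 2)]
    omega
  subst ha1
  exact represented_of_unit_vector (by linarith) hdet hM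

/-! ### Values of x² + y² + 3z² from primes in progressions -/

/-- A prime `p` with `s² p = b M - 3` modulo which `-b` is a square gives a representation of `M`. -/
theorem represented_of_neg_isSquare {M b s : ℤ} {p : ℕ} (hp : p.Prime) (hM : M % 8 = 5) (hb : 0 < b)
    (hsq : IsSquare ((-b : ℤ) : ZMod p)) (hdet : M * b - s ^ 2 * p = 3) :
    ∃ x y z : ℤ, x ^ 2 + y ^ 2 + 3 * z ^ 2 = M := by
  have hp0 : (0 : ℤ) < p := by exact_mod_cast hp.pos
  obtain ⟨r, hr⟩ := hsq
  obtain ⟨a, rfl⟩ := ZMod.intCast_surjective r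
  have hdvd : (p : ℤ) ∣ a ^ 2 + b := by
    rw [← ZMod.intCast_zmod_eq_zero_iff_dvd]
    push_cast at hr ⊢
    linear_combination -hr
  obtain ⟨k, hk⟩ := hdvd
  have hk0 : 0 < k := by
    by_contra h
    nlinarith [sq_nonneg a]
  -- The Gram matrix has rows (k, a, s), (a, p, 0), (s, 0, M), with kp - a² = b.
  rcases represented_of_ternaryDet_eq_three (M := M) _ k p M 0 s a rfl hk0 (by linarith)
    (by rw [ternaryDet]; linear_combination hdet - M * hk) ⟨0, 0, 1, by rw [ternaryForm]; ring⟩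
    with h | ⟨x, y, z, h⟩
  · exact h
  exfalso
  have h8 : (x ^ 2 + 2 * (y ^ 2 + y * z + z ^ 2)) % 8 = 5 := by rw [h]; exact hM
  have key : ∀ x y z : ZMod 8, x ^ 2 + 2 * (y ^ 2 + y * z + z ^ 2) ≠ 5 := by decide
  apply key x y z
  have := (ZMod.intCast_eq_intCast_iff_dvd_sub 5 (x ^ 2 + 2 * (y ^ 2 + y * z + z ^ 2)) 8).2
    (by push_cast; omega)
  push_cast at this
  exact this.symm

open NumberTheorySymbols in
theorem jacobiSym_three_of_mod_twelve {n : ℕ} (hn : n % 12 = 5) : J(3 | n) = -1 := by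
  have h := jacobiSym.quadratic_reciprocity_one_mod_four' (a := 3) (b := n) (by decide) (by omega)
  rw [Nat.cast_ofNat] at h
  rw [h, jacobiSym.mod_left, show (n : ℤ) % (3 : ℕ) = 2 by push_cast; omega]
  norm_num

-- Here (-2/p) = -1, and (n/p) = (p/n) = -1 by reciprocity.
open NumberTheorySymbols in
theorem isSquare_neg_two_mul {n p : ℕ} (hp : p.Prime) (hn : n % 12 = 5) (hp8 : p % 8 = 7)
    (h : J(p | n) = -1) : IsSquare ((-(2 * n) : ℤ) : ZMod p) := by
  have : Fact p.Prime := ⟨hp⟩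
  apply ZMod.isSquare_of_jacobiSym_eq_one
  have hodd : Odd p := Nat.odd_iff.2 (by omega)
  rw [show (-(2 * n) : ℤ) = -2 * n by ring, jacobiSym.mul_left, jacobiSym.at_neg_two hodd,
    jacobiSym.quadratic_reciprocity_one_mod_four (by omega) hodd, h, ZMod.χ₈'_nat_eq_if_mod_eight]
  simp [hp8, show p % 2 = 1 by omega]

-- Take p = 2nM - 3 with n = 12t + 5, so p ≡ 10M - 3 (mod 24M); then (p/n) = (-3/n) = -1.
open NumberTheorySymbols in
theorem represented_of_not_three_dvd {M : ℕ} (h8 : M % 8 = 5) (h3 : ¬ 3 ∣ M) :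
    ∃ x y z : ℤ, x ^ 2 + y ^ 2 + 3 * z ^ 2 = M := by
  have hcop : IsCoprime (10 * M - 3 : ℤ) ((24 * M : ℕ) : ℤ) := by
    have c3 : IsCoprime (M : ℤ) 3 :=
      Nat.isCoprime_iff_coprime.2 ((Nat.Prime.coprime_iff_not_dvd Nat.prime_three).2 h3).symm
    have e1 : IsCoprime (10 * M - 3 : ℤ) 8 := by
      obtain ⟨m, hm⟩ : ∃ m, M = 8 * m + 5 := ⟨M / 8, by omega⟩
      exact ⟨-1, 10 * m + 6, by rw [hm]; push_cast; ring⟩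
    have e2 : IsCoprime (10 * M - 3 : ℤ) 3 := by
      obtain ⟨u, v, huv⟩ := c3
      exact ⟨u, v - 3 * M * u + u, by linear_combination huv⟩
    have e3 : IsCoprime (10 * M - 3 : ℤ) M := by
      obtain ⟨u, v, huv⟩ := c3
      exact ⟨-v, u + 10 * v, by linear_combination huv⟩
    have := (e1.mul_right e2).mul_right e3
    push_cast
    norm_num at this
    exact this
  obtain ⟨p, hpM, hp, hmod⟩ := Nat.forall_exists_prime_gt_and_zmodEq (10 * M) (by omega) hcop
  obtain ⟨t, ht⟩ := hmod.symm.dvd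
  push_cast at ht
  have ht0 : 0 ≤ t := by
    by_contra h
    nlinarith
  lift t to ℕ using ht0
  have hpe : (p : ℤ) = 2 * (12 * t + 5 : ℕ) * M - 3 := by push_cast; linarith
  have hn : (12 * t + 5) % 12 = 5 := by omega
  have hp8 : p % 8 = 7 := by
    obtain ⟨m, hm⟩ : ∃ m, M = 8 * m + 5 := ⟨M / 8, by omega⟩
    have : (p : ℤ) = 8 * (3 * M * t + 10 * m + 5) + 7 := by rw [hm] at hpe ⊢; push_cast at *; linarith
    omega
  refine represented_of_neg_isSquare (s := 1) hp (by omega)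
    (by positivity : (0 : ℤ) < 2 * (12 * t + 5 : ℕ)) (isSquare_neg_two_mul hp hn hp8 ?_)
    (by rw [hpe]; ring)
  have hm1 : J(-1 | 12 * t + 5) = 1 := by
    rw [jacobiSym.at_neg_one (Nat.odd_iff.2 (by omega)), ZMod.χ₄_nat_one_mod_four (by omega)]
  have h1 : J(p | 12 * t + 5) = J(-1 * 3 | 12 * t + 5) :=
    jacobiSym.mod_left' (Int.modEq_iff_dvd.2 ⟨-(2 * M), by rw [hpe]; ring⟩)
  rw [h1, jacobiSym.mul_left, hm1, jacobiSym_three_of_mod_twelve hn, one_mul]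

-- With M = 3N, take s = 3 and 3p = 2nN - 1, n = 12t + 5. The residue 80m + 23 is (10N - 1)/3, the
-- case t = 0.
open NumberTheorySymbols in
theorem represented_three_mul {N : ℕ} (h8 : N % 8 = 7) (h3 : N % 3 = 1) :
    ∃ x y z : ℤ, x ^ 2 + y ^ 2 + 3 * z ^ 2 = 3 * N := by
  obtain ⟨m, hm⟩ : ∃ m, N = 24 * m + 7 := ⟨N / 24, by omega⟩
  have hcop : IsCoprime (80 * m + 23 : ℤ) ((8 * N : ℕ) : ℤ) := by
    have e1 : IsCoprime (80 * m + 23 : ℤ) 8 := ⟨-1, 10 * m + 3, by ring⟩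
    have e2 : IsCoprime (80 * m + 23 : ℤ) N := ⟨-3, 10, by rw [hm]; push_cast; ring⟩
    push_cast
    exact e1.mul_right e2
  obtain ⟨p, hpM, hp, hmod⟩ := Nat.forall_exists_prime_gt_and_zmodEq (80 * m + 23) (by omega) hcop
  obtain ⟨t, ht⟩ := hmod.symm.dvd
  push_cast at ht
  have ht0 : 0 ≤ t := by
    by_contra h
    nlinarith
  lift t to ℕ using ht0
  have hpe : 3 * (p : ℤ) = 2 * (12 * t + 5 : ℕ) * N - 1 := by
    have : (N : ℤ) = 24 * m + 7 := by exact_mod_cast hm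
    push_cast; linear_combination 3 * ht - 10 * this
  have hn : (12 * t + 5) % 12 = 5 := by omega
  have hp8 : p % 8 = 7 := by
    have : (p : ℤ) = 8 * (N * t + 10 * m + 2) + 7 := by linarith
    omega
  refine represented_of_neg_isSquare (M := 3 * N) (s := 3) hp (by omega)
    (by positivity : (0 : ℤ) < 2 * (12 * t + 5 : ℕ)) (isSquare_neg_two_mul hp hn hp8 ?_)
    (by linear_combination -3 * hpe)
  have hm1 : J(-1 | 12 * t + 5) = 1 := by
    rw [jacobiSym.at_neg_one (Nat.odd_iff.2 (by omega)), ZMod.χ₄_nat_one_mod_four (by omega)]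
  have h1 : J(3 * p | 12 * t + 5) = J(-1 | 12 * t + 5) :=
    jacobiSym.mod_left' (Int.modEq_iff_dvd.2 ⟨-(2 * N), by rw [hpe]; ring⟩)
  rw [jacobiSym.mul_left, hm1, jacobiSym_three_of_mod_twelve hn] at h1
  linarith

theorem three_dvd_of_three_dvd_sq_add_sq {x y : ℤ} (h : (3 : ℤ) ∣ x ^ 2 + y ^ 2) :
    (3 : ℤ) ∣ x ∧ (3 : ℤ) ∣ y := by
  have key : ∀ x y : ZMod 3, x ^ 2 + y ^ 2 = 0 → x = 0 ∧ y = 0 := by decide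
  have := key x y (by
    have := (ZMod.intCast_zmod_eq_zero_iff_dvd (x ^ 2 + y ^ 2) 3).2 (by exact_mod_cast h)
    exact_mod_cast this)
  exact ⟨by exact_mod_cast (ZMod.intCast_zmod_eq_zero_iff_dvd x 3).1 this.1,
    by exact_mod_cast (ZMod.intCast_zmod_eq_zero_iff_dvd y 3).1 this.2⟩

/-! ### Values of X² + 3Y² + 3Z² -/

/-- The form `X² + 3 Y² + 3 Z²` represents every positive `N ≡ 7 (mod 8)` with `N ≡ 1 (mod 3)`. -/
theorem represented_of_mod_three_eq_one {N : ℤ} (h0 : 0 < N) (h8 : N % 8 = 7) (h3 : N % 3 = 1) :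
    ∃ X Y Z : ℤ, X ^ 2 + 3 * Y ^ 2 + 3 * Z ^ 2 = N := by
  lift N to ℕ using h0.le
  obtain ⟨x, y, z, h⟩ := represented_three_mul (N := N) (by omega) (by omega)
  obtain ⟨⟨a, rfl⟩, ⟨b, rfl⟩⟩ :=
    three_dvd_of_three_dvd_sq_add_sq (x := x) (y := y) ⟨N - z ^ 2, by linarith⟩
  exact ⟨z, a, b, by linarith⟩

/-- The form `X² + 3 Y² + 3 Z²` represents `3 M` for every positive `M ≡ 5 (mod 8)` that is neither
`0` nor `6` modulo `9`. -/
theorem represented_three_mul_of_mod_nine {M : ℤ} (h0 : 0 < M) (h8 : M % 8 = 5) (h9 : M % 9 ≠ 0)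
    (h9' : M % 9 ≠ 6) : ∃ X Y Z : ℤ, X ^ 2 + 3 * Y ^ 2 + 3 * Z ^ 2 = 3 * M := by
  lift M to ℕ using h0.le
  have : ∃ x y z : ℤ, x ^ 2 + y ^ 2 + 3 * z ^ 2 = M := by
    by_cases h3 : 3 ∣ M
    · obtain ⟨N, rfl⟩ := h3
      simpa using represented_three_mul (N := N) (by omega) (by omega)
    · exact represented_of_not_three_dvd (by omega) h3
  obtain ⟨x, y, z, h⟩ := this
  exact ⟨3 * z, x, y, by linarith⟩

/-- Modulo 4, either all coordinates are odd or only Y or only Z is. -/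
theorem exists_odd_of_mod_eight_eq_seven {N X Y Z : ℤ} (h8 : N % 8 = 7)
    (h : X ^ 2 + 3 * Y ^ 2 + 3 * Z ^ 2 = N) : ∃ X' Y' Z' : ℤ,
      X' ^ 2 + 3 * Y' ^ 2 + 3 * Z' ^ 2 = N ∧ X' % 2 = 1 ∧ Y' % 2 = 1 ∧ Z' % 2 = 1 := by
  -- multiplication by a unit of the Eisenstein integers makes `X` and `Z` odd
  have step : ∀ Y X' Z' : ℤ, (2 * X') ^ 2 + 3 * Y ^ 2 + 3 * (2 * Z') ^ 2 = N → Y % 2 = 1 →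
      ∃ X' Y' Z' : ℤ, X' ^ 2 + 3 * Y' ^ 2 + 3 * Z' ^ 2 = N ∧
        X' % 2 = 1 ∧ Y' % 2 = 1 ∧ Z' % 2 = 1 := by
    intro Y X' Z' h hY
    have hpar : (X' + Z') % 2 = 1 := by
      obtain ⟨k, rfl⟩ : ∃ k, Y = 2 * k + 1 := ⟨Y / 2, by omega⟩
      by_contra hne
      obtain ⟨l, rfl⟩ : ∃ l, X' = 2 * l - Z' := ⟨(X' + Z') / 2, by omega⟩
      obtain ⟨c, hc⟩ := Int.even_mul_succ_self k
      have : N = 8 * (2 * l ^ 2 - 2 * l * Z' + 2 * Z' ^ 2 + 3 * c) + 3 := by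
        rw [← h]; linear_combination 12 * hc
      omega
    exact ⟨X' + 3 * Z', Y, X' - Z', by rw [← h]; ring, by omega, hY, by omega⟩
  have hsq : ∀ t : ℤ, t % 2 = 0 ∧ (∃ k, t = 2 * k) ∧ t ^ 2 % 4 = 0 ∨
      t % 2 = 1 ∧ t ^ 2 % 4 = 1 := by
    intro t
    rcases Int.emod_two_eq_zero_or_one t with ht | ht
    · obtain ⟨k, rfl⟩ := Int.dvd_of_emod_eq_zero ht
      exact Or.inl ⟨ht, ⟨k, rfl⟩, by ring_nf; omega⟩
    · obtain ⟨k, rfl⟩ : ∃ k, t = 2 * k + 1 := ⟨t / 2, by omega⟩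
      exact Or.inr ⟨ht, by ring_nf; omega⟩
  rcases hsq X with ⟨hX, ⟨a, rfl⟩, hX4⟩ | ⟨hX, hX4⟩ <;>
  rcases hsq Y with ⟨hY, ⟨b, rfl⟩, hY4⟩ | ⟨hY, hY4⟩ <;>
  rcases hsq Z with ⟨hZ, ⟨c, rfl⟩, hZ4⟩ | ⟨hZ, hZ4⟩
  · omega
  · exact step Z a b (by linarith) hZ
  · exact step Y a c h hY
  · omega
  · omega
  · omega
  · omega
  · exact ⟨X, Y, Z, h, hX, hY, hZ⟩

/-! ### The halved form and its values -/

/-- Half of `formFPoly`. -/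
def halfF (x y z u : ℤ) : ℤ :=
  4 * x ^ 2 + 4 * y ^ 2 + 4 * z ^ 2 - 4 * x * y - 4 * x * z + 2 * y * z
    + u * (4 * u - x - y - z)

theorem formFPoly_eq (x y z u : ℤ) : formFPoly x y z u = 2 * halfF x y z u := by
  rw [formFPoly, halfF]; ring

theorem sixteen_mul_halfF (x y z u : ℤ) : 16 * halfF x y z u =
    (4 * (2 * x - y - z) - u) ^ 2 + 3 * (4 * y - u) ^ 2 + 3 * (4 * z - u) ^ 2 + 57 * u ^ 2 := by
  rw [halfF]; ring

theorem exists_halfF_eq {m u X Y Z : ℤ} (hu : u % 2 = 1)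
    (h : X ^ 2 + 3 * Y ^ 2 + 3 * Z ^ 2 = 16 * m - 57 * u ^ 2) :
    ∃ x y z, halfF x y z u = m := by
  have hu8 : u ^ 2 % 8 = 1 := by
    obtain ⟨k, rfl⟩ : ∃ k, u = 2 * k + 1 := ⟨u / 2, by omega⟩
    obtain ⟨c, hc⟩ := Int.even_mul_succ_self k
    rw [show (2 * k + 1) ^ 2 = 8 * c + 1 by linear_combination 4 * hc]
    omega
  obtain ⟨X, Y, Z, h, hX, hY, hZ⟩ := exists_odd_of_mod_eight_eq_seven (by omega) h
  -- Changing signs makes X, Y, Z all ≡ -u (mod 4), as the diagonalization requires.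
  have hsign : ∀ t : ℤ, t % 2 = 1 → ∃ k, t ^ 2 = (4 * k - u) ^ 2 := by
    intro t ht
    rcases (by omega : (t + u) % 4 = 0 ∨ (-t + u) % 4 = 0) with h4 | h4
    · exact ⟨(t + u) / 4, by rw [show 4 * ((t + u) / 4) - u = t by omega]⟩
    · exact ⟨(-t + u) / 4, by rw [show 4 * ((-t + u) / 4) - u = -t by omega]; ring⟩
  obtain ⟨A, hA⟩ := hsign X hX
  obtain ⟨y, hy⟩ := hsign Y hY
  obtain ⟨z, hz⟩ := hsign Z hZ
  have heq : 2 * (A ^ 2 + 3 * y ^ 2 + 3 * z ^ 2 + 4 * u ^ 2 - m) = u * (A + 3 * y + 3 * z) := by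
    rw [hA, hy, hz] at h; linarith
  have hpar : (A + y + z) % 2 = 0 := by
    rcases Int.even_mul.1 (heq ▸ even_two_mul _ : Even (u * (A + 3 * y + 3 * z))) with h2 | h2
    · rw [Int.even_iff] at h2; omega
    · rw [Int.even_iff] at h2; omega
  obtain ⟨x, hx⟩ := Int.dvd_of_emod_eq_zero hpar
  refine ⟨x, y, z, ?_⟩
  have h16 := sixteen_mul_halfF x y z u
  rw [show 2 * x - y - z = A by linarith, ← hA, ← hy, ← hz, h] at h16
  linarith

theorem halfF_modEq_sq (x y z u : ℤ) : halfF x y z u ≡ (x + y + z + u) ^ 2 [ZMOD 3] := by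
  rw [Int.modEq_iff_dvd]
  exact ⟨-(x ^ 2 + y ^ 2 + z ^ 2 + u ^ 2) + 2 * x * y + 2 * x * z + x * u + y * u + z * u,
    by rw [halfF]; ring⟩

theorem halfF_mod_three (x y z u : ℤ) : halfF x y z u % 3 = 0 ∨ halfF x y z u % 3 = 1 := by
  rw [halfF_modEq_sq x y z u, sq, Int.mul_emod]
  rcases (by omega : (x + y + z + u) % 3 = 0 ∨ (x + y + z + u) % 3 = 1 ∨ (x + y + z + u) % 3 = 2)
    with h | h | h <;> simp [h]

theorem halfF_pos {x y z u : ℤ} (h : ¬ (x = 0 ∧ y = 0 ∧ z = 0 ∧ u = 0)) : 0 < halfF x y z u := by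
  by_contra hle
  have h16 := sixteen_mul_halfF x y z u
  have hu : u = 0 := by
    apply pow_eq_zero_iff two_ne_zero |>.1
    nlinarith [sq_nonneg (4 * (2 * x - y - z) - u), sq_nonneg (4 * y - u), sq_nonneg (4 * z - u),
      sq_nonneg u]
  subst hu
  have hy : y = 0 := by
    apply pow_eq_zero_iff two_ne_zero |>.1
    nlinarith [sq_nonneg (4 * (2 * x - y - z) - 0), sq_nonneg y, sq_nonneg z]
  have hz : z = 0 := by
    apply pow_eq_zero_iff two_ne_zero |>.1
    nlinarith [sq_nonneg (4 * (2 * x - y - z) - 0), sq_nonneg y, sq_nonneg z]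
  subst hy hz
  have hx : x = 0 := by
    apply pow_eq_zero_iff two_ne_zero |>.1
    nlinarith [sq_nonneg x]
  exact h ⟨hx, rfl, rfl, rfl⟩

/-- If u ≠ 0, then 16h ≥ 57. If u = 0, then h is even, and 2 is excluded modulo 3. -/
theorem four_le_halfF {x y z u : ℤ} (h : ¬ (x = 0 ∧ y = 0 ∧ z = 0 ∧ u = 0)) :
    4 ≤ halfF x y z u := by
  have hpos := halfF_pos h
  have h3 := halfF_mod_three x y z u
  by_cases hu : u = 0
  · subst hu
    have : halfF x y z 0
        = 2 * (2 * x ^ 2 + 2 * y ^ 2 + 2 * z ^ 2 - 2 * x * y - 2 * x * z + y * z) := by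
      rw [halfF]; ring
    omega
  · have h16 := sixteen_mul_halfF x y z u
    have hu1 : 0 < u ^ 2 := by positivity
    nlinarith [sq_nonneg (4 * (2 * x - y - z) - u), sq_nonneg (4 * y - u), sq_nonneg (4 * z - u)]

/-- Every integer `m ≥ 4` with `m ≡ 0, 1 (mod 3)` is a value of `halfF` at a vector that has a unit
coordinate, or whose last coordinate is `3` while `9 ∤ m`. -/
theorem exists_halfF_eq_of_mod_three {m : ℤ} (h4 : 4 ≤ m) (h3 : m % 3 = 0 ∨ m % 3 = 1) :
    ∃ x y z u, halfF x y z u = m ∧ (IsUnit u ∨ IsUnit x ∨ u = 3 ∧ ¬ 9 ∣ m) := by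
  rcases h3 with h3 | h3
  swap
  · obtain ⟨X, Y, Z, h⟩ := represented_of_mod_three_eq_one (N := 16 * m - 57) (by omega) (by omega)
      (by omega)
    obtain ⟨x, y, z, h⟩ := exists_halfF_eq (u := 1) rfl h
    exact ⟨x, y, z, 1, h, Or.inl isUnit_one⟩
  obtain ⟨k, rfl⟩ := Int.dvd_of_emod_eq_zero h3
  -- These are the classes where 16k - 19 is 6 or 0 modulo 9. There u = 3 works, 16k - 171 being
  -- positive from k = 11 on.
  by_cases hk : k % 9 = 1 ∨ k % 9 = 4
  swap
  · obtain ⟨X, Y, Z, h⟩ := represented_three_mul_of_mod_nine (M := 16 * k - 19) (by omega)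
      (by omega) (by omega) (by omega)
    obtain ⟨x, y, z, h⟩ := exists_halfF_eq (u := 1) (m := 3 * k) rfl (by rw [h]; ring)
    exact ⟨x, y, z, 1, h, Or.inl isUnit_one⟩
  by_cases hk11 : 11 ≤ k
  · obtain ⟨X, Y, Z, h⟩ := represented_three_mul_of_mod_nine (M := 16 * k - 171) (by omega)
      (by omega) (by omega) (by omega)
    obtain ⟨x, y, z, h⟩ := exists_halfF_eq (u := 3) (m := 3 * k) rfl (by rw [h]; ring)
    exact ⟨x, y, z, 3, h, Or.inr (Or.inr ⟨rfl, by omega⟩)⟩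
  obtain rfl | rfl : k = 4 ∨ k = 10 := by omega
  · exact ⟨0, -1, -1, -1, by rw [halfF]; norm_num, Or.inl (by simp)⟩
  · exact ⟨-1, -3, 1, 0, by rw [halfF]; norm_num, Or.inr (Or.inl (by simp))⟩

/-- If u = 3, a nontrivial common divisor is 3 up to sign, and then 9 divides h by homogeneity. -/
theorem isPrimitiveVector_of_halfF {x y z u : ℤ}
    (h : IsUnit u ∨ IsUnit x ∨ u = 3 ∧ ¬ 9 ∣ halfF x y z u) : IsPrimitiveVector ![x, y, z, u] := by
  set d := Finset.univ.gcd ![x, y, z, u] with hd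
  have hdvd : ∀ i, d ∣ ![x, y, z, u] i := fun i => Finset.gcd_dvd (Finset.mem_univ i)
  have hx : d ∣ x := hdvd 0
  have hy : d ∣ y := hdvd 1
  have hz : d ∣ z := hdvd 2
  have hu : d ∣ u := hdvd 3
  have hunit : IsUnit d := by
    rcases h with h | h | ⟨rfl, h⟩
    · exact isUnit_of_dvd_unit hu h
    · exact isUnit_of_dvd_unit hx h
    · rcases (Int.prime_three.irreducible.dvd_iff).1 hu with h' | h'
      · exact h'
      · exfalso
        obtain ⟨a, rfl⟩ := h'.dvd.trans hx
        obtain ⟨b, rfl⟩ := h'.dvd.trans hy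
        obtain ⟨c, rfl⟩ := h'.dvd.trans hz
        exact h ⟨halfF a b c 1, by rw [halfF, halfF]; ring⟩
  have : normalize d = d := Finset.normalize_gcd
  rw [IsPrimitiveVector, ← hd, ← this]
  exact normalize_eq_one.2 hunit

theorem theorem3p3 :
    formF.PosDef ∧ primitiveImage formF = hassettSet := by
  refine ⟨?_, Set.ext fun n => ⟨?_, ?_⟩⟩
  · intro v hv
    rw [formF_apply, formFPoly_eq]
    have := halfF_pos (x := v 0) (y := v 1) (z := v 2) (u := v 3) (by
      rintro ⟨h0, h1, h2, h3⟩
      exact hv (funext fun i => by fin_cases i <;> assumption))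
    linarith
  · rintro ⟨v, hv, rfl⟩
    rw [formF_apply, formFPoly_eq]
    have h4 := four_le_halfF (x := v 0) (y := v 1) (z := v 2) (u := v 3) (by
      rintro ⟨h0, h1, h2, h3⟩
      have : v = 0 := funext fun i => by fin_cases i <;> assumption
      rw [IsPrimitiveVector, this, Finset.gcd_eq_zero_iff.2 (by simp)] at hv
      exact zero_ne_one hv)
    have h3 := halfF_mod_three (v 0) (v 1) (v 2) (v 3)
    refine ⟨by linarith, ?_⟩
    rw [Int.ModEq, Int.ModEq]
    omega
  · rintro ⟨h8, h6⟩
    rw [Int.ModEq, Int.ModEq] at h6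
    obtain ⟨x, y, z, u, h, hu⟩ := exists_halfF_eq_of_mod_three (m := n / 2) (by omega) (by omega)
    refine ⟨![x, y, z, u], isPrimitiveVector_of_halfF (by rwa [h]), ?_⟩
    change formFPoly x y z u = n
    rw [formFPoly_eq, h]
    omega
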